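/- Bulgarian Solitaire is the map $\beta$ on integer partitions that takes one card from each pile (part) and forms a new pile of the cards taken. To a word $b_1b_2\cdots b_m$ in the letters $B,W$ associate the partition $(m-1,m-2,\ldots,0)+(s_1,\ldots,s_m)$, where $s_i=1$ if $b_i=B$ and $s_i=0$ if $b_i=W$ (a last part equal to $0$ is omitted). A necklace $N$ is a class of words under cyclic rotation. Let $\mathcal C_N$ be the set of partitions associated with the words in $N$, let $\mathcal O_N$ be the set of partitions $\lambda$ with $\beta^j(\lambda)\in\mathcal C_N$ for some $j>0$, let $\operatorname{level}(\lambda)=\min\{j\ge 0:\beta^j(\lambda)\in\mathcal C_N\}$ for $\lambda\in\mathcal O_N$, and let $$\mathcal D_N(x)=\sum_{\lambda\in\mathcal O_N}x^{\operatorname{level}(\lambda)}.$$ For a word $P$, let $P^\ell$ be the concatenation of $\ell$ copies of $P$ (regarded as a necklace), and let $$H_P(x)=\lim_{\ell\to\infty}\mathcal D_{P^\ell}(x),$$ a coefficientwise limit of formal power series. **Theorem 1.2.** For every $k\ge 1$ the limits $H_{B(WB)^k}(x)$ and $H_{W(BW)^k}(x)$ exist, and $$H_{B(WB)^k}(x)=H_{W(BW)^k}(x).$$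 -/

import Mathlib

open Filter Topology
open scoped PowerSeries PowerSeries.WithPiTopology

namespace BulgarianSolitaire

theorem sum_move {n : ℕ} (p : n.Partition) :
    (Multiset.card p.parts ::ₘ p.parts.map (fun a => a - 1)).sum = n := by
  have key : ∀ s : Multiset ℕ, (∀ a ∈ s, 0 < a) →
      Multiset.card s + (s.map (fun a => a - 1)).sum = s.sum := by
    intro s
    induction s using Multiset.induction_on with
    | empty => simp
    | cons a s ih =>
      intro h
      have ha : 0 < a := h a (by simp)
      have hs := ih (fun b hb => h b (by simp [hb]))
      simp only [Multiset.card_cons, Multiset.map_cons, Multiset.sum_cons]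
      omega
  rw [Multiset.sum_cons, key p.parts (fun a ha => p.parts_pos ha), p.parts_sum]

/-- The Bulgarian Solitaire move `β` on the partitions of `n`: take one card from each pile and
form a new pile of the cards taken (`Nat.Partition.ofSums` discards the empty piles). -/
def move {n : ℕ} (p : n.Partition) : n.Partition :=
  Nat.Partition.ofSums n (Multiset.card p.parts ::ₘ p.parts.map (fun a => a - 1)) (sum_move p)

/-- The two letters, black and white. -/
inductive Bead where
  | B
  | W
  deriving DecidableEq

/-- The number `1` for a black bead and `0` for a white one. -/
def Bead.weight : Bead → ℕ
  | .B => 1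
  | .W => 0

/-- A necklace: a word in the letters `B`, `W` up to cyclic rotation. -/
abbrev Necklace := Cycle Bead

/-- The sequence `(m - 1, m - 2, …, 0) + (s₁, s₂, …, s_m)` of a word `b₁ b₂ ⋯ b_m`, where
`s_i = 1` if `b_i = B` and `s_i = 0` if `b_i = W`. Its last entry may be `0`. -/
def wordParts : List Bead → List ℕ
  | [] => []
  | b :: w => (w.length + b.weight) :: wordParts w

/-- The number of cards that belongs to a necklace of length `m`: `m.choose 2` plus the
number of black beads. -/
def cards (N : Necklace) : ℕ :=
  N.length.choose 2 + N.toMultiset.count Bead.B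

/-- `wordParts w` sums to the number of cards of the necklace of `w`. -/
theorem wordParts_sum (w : List Bead) : (wordParts w).sum = cards (w : Cycle Bead) := by
  induction w with
  | nil => simp [wordParts, cards]
  | cons b w ih =>
    simp only [cards, Cycle.length_coe, Cycle.coe_toMultiset, Multiset.coe_count] at ih
    cases b <;>
      simp [wordParts, cards, Bead.weight, ih, Nat.choose_succ_succ'] <;> omega

/-- The recurrent cycle `𝒞_N`: the partitions given by the words in the class `N`. -/
def recurrentSet (N : Necklace) : Set (cards N).Partition :=
  {p | ∃ w : List Bead, (w : Cycle Bead) = N ∧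
    p.parts = ((wordParts w).filter (fun a => a ≠ 0) : List ℕ)}

/-- The orbit `𝒪_N`: the partitions that reach `𝒞_N`. -/
def orbit (N : Necklace) : Set (cards N).Partition :=
  {p | ∃ k : ℕ, 0 < k ∧ move^[k] p ∈ recurrentSet N}

/-- The level of a partition in the orbit of `N`: the least number of moves that take it
to `𝒞_N`. -/
noncomputable def level (N : Necklace) (p : (cards N).Partition) : ℕ :=
  sInf {k : ℕ | move^[k] p ∈ recurrentSet N}

open Classical in
/-- The level size generating function `𝒟_N(x) = ∑_{λ ∈ 𝒪_N} x ^ level(λ)`. -/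
noncomputable def levelGF (N : Necklace) : ℤ⟦X⟧ :=
  ∑ p : (cards N).Partition with p ∈ orbit N, PowerSeries.X ^ level N p

/-- The concatenation `w^l = w w ⋯ w` of `l` copies of a word. -/
def wordPow (w : List Bead) (l : ℕ) : List Bead :=
  (List.replicate l w).flatten

/-- `H` is the limit `H_P(x) = lim_{l → ∞} 𝒟_{P^l}(x)` in `ℤ⟦X⟧`, where `ℤ` is discrete and
`ℤ⟦X⟧` has the topology of coefficientwise convergence. -/
def IsLimitGF (P : List Bead) (H : ℤ⟦X⟧) : Prop :=
  Tendsto (fun l : ℕ => levelGF (wordPow P l : Cycle Bead)) atTop (𝓝 H)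

/-- The word `B(WB)^k`. -/
def wordBWB (k : ℕ) : List Bead := Bead.B :: wordPow [Bead.W, Bead.B] k

/-- The word `W(BW)^k`. -/
def wordWBW (k : ℕ) : List Bead := Bead.W :: wordPow [Bead.B, Bead.W] k

end BulgarianSolitaire

/-!
Dealing out the pile `a` of a partition `q` undoes a move exactly when `q` has at most `a + 1`
piles, and the new number of piles is then `a`. Measured against piles that all gain one card per
backward move, a backward move chooses a pile, and the next choice must not be more than two cards
smaller; the piles of size `1` that arise on the way are too small to be chosen for a long time.

For a recurrent partition the piles that can be chosen come from a periodic sequence of beads.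
Both `B(WB)^k` and `W(BW)^k` are rotations of `X(WB)^k`, with `X = B` or `X = W`. The two beads of
a pair `WB` give two piles of equal size, so the piles form groups: pairs, and one single pile for
each `X`. Consecutive groups differ in size by `1` or `2`, and groups two apart differ by at least
`3` (`isSpaced_groupHeight`). Hence the choices that are allowed are the groups up to the one
just after the group chosen last, whether `X` is `B` or `W`: the color of `X` shifts the single
piles by one card, which does not affect this rule. The number of `j`-fold preimages of a recurrent
partition is therefore `groupCount`, which involves only the group sizes
(`TopProfile.card_iterate_preimage`, `topProfile_shiftedWord`), once the number of periods is large
compared with `j`.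

Summing over the `2k + 1` recurrent partitions gives the number of partitions of level at most `j`
(`reachCount_shiftedWord`). It stabilizes, at the same value for both words, and the
coefficients of the level size generating function are differences of consecutive such numbers.
-/

namespace BulgarianSolitaire

/-! ### Predecessors of a partition -/

/-- The piles before a move that yields the piles `s` and whose new pile is `a`: the pile `a` is
dealt out again, one card to each other pile, and its remaining cards become piles of size `1`. -/
def predParts (s : Multiset ℕ) (a : ℕ) : Multiset ℕ :=
  (s.erase a).map (· + 1) + Multiset.replicate (a + 1 - Multiset.card s) 1

theorem parts_move {n : ℕ} (p : n.Partition) :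
    (move p).parts =
      (Multiset.card p.parts ::ₘ p.parts.map (fun a => a - 1)).filter (· ≠ 0) := rfl

theorem card_predParts {s : Multiset ℕ} {a : ℕ} (ha : a ∈ s) (hs : Multiset.card s ≤ a + 1) :
    Multiset.card (predParts s a) = a := by
  have h1 : 0 < Multiset.card s := Multiset.card_pos_iff_exists_mem.2 ⟨a, ha⟩
  simp only [predParts, Multiset.card_add, Multiset.card_map, Multiset.card_erase_of_mem ha,
    Multiset.card_replicate, Nat.pred_eq_sub_one]
  omega

theorem sum_predParts {s : Multiset ℕ} {a : ℕ} (ha : a ∈ s) (hs : Multiset.card s ≤ a + 1) :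
    (predParts s a).sum = s.sum := by
  have h1 : 0 < Multiset.card s := Multiset.card_pos_iff_exists_mem.2 ⟨a, ha⟩
  have h2 : s.sum = a + (s.erase a).sum := by
    conv_lhs => rw [← Multiset.cons_erase ha, Multiset.sum_cons]
  simp only [predParts, Multiset.sum_add, Multiset.sum_map_add, Multiset.map_id',
    Multiset.map_const', Multiset.sum_replicate, Multiset.card_erase_of_mem ha,
    Nat.pred_eq_sub_one, smul_eq_mul]
  omega

theorem move_eq_of_parts_eq_predParts {n : ℕ} {p q : n.Partition} {a : ℕ} (ha : a ∈ q.parts)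
    (hq : Multiset.card q.parts ≤ a + 1) (hp : p.parts = predParts q.parts a) : move p = q := by
  have ha0 : a ≠ 0 := (q.parts_pos ha).ne'
  have h : (q.parts.erase a).filter (· ≠ 0) = q.parts.erase a :=
    Multiset.filter_eq_self.2 fun b hb => (q.parts_pos (Multiset.mem_of_mem_erase hb)).ne'
  apply Nat.Partition.ext
  rw [parts_move, hp, card_predParts ha hq, Multiset.filter_cons_of_pos (p := (· ≠ 0)) _ ha0,
    predParts, Multiset.map_add, Multiset.map_map, Multiset.map_replicate, Multiset.filter_add]
  simp only [Function.comp_def, Nat.add_sub_cancel, Multiset.map_id', h, Nat.sub_self]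
  rw [Multiset.filter_eq_nil.2, add_zero, Multiset.cons_erase ha]
  intro b hb
  simp [Multiset.eq_of_mem_replicate hb]

/-- A multiset of positive numbers is recovered from its entries lowered by one, once the number
of its ones is known. -/
theorem eq_map_succ_add_replicate (s : Multiset ℕ) (hs : ∀ a ∈ s, 0 < a) :
    Multiset.card ((s.map (fun a => a - 1)).filter (· ≠ 0)) ≤ Multiset.card s ∧
    s = ((s.map (fun a => a - 1)).filter (· ≠ 0)).map (· + 1) + Multiset.replicate
      (Multiset.card s - Multiset.card ((s.map (fun a => a - 1)).filter (· ≠ 0))) 1 := by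
  induction s using Multiset.induction_on with
  | empty => simp
  | cons a s ih =>
    obtain ⟨h1, h2⟩ := ih fun b hb => hs b (Multiset.mem_cons_of_mem hb)
    have ha := hs a (Multiset.mem_cons_self a s)
    rw [Multiset.map_cons]
    set F := (s.map (fun a => a - 1)).filter (· ≠ 0) with hF
    by_cases h : a - 1 ≠ 0
    · rw [Multiset.filter_cons_of_pos (p := (· ≠ 0)) _ h, ← hF]
      refine ⟨by simpa using h1, ?_⟩
      rw [Multiset.card_cons, Multiset.card_cons, Nat.add_sub_add_right, Multiset.map_cons,
        Nat.sub_add_cancel ha, Multiset.cons_add, ← h2]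
    · have ha1 : a = 1 := by omega
      rw [Multiset.filter_cons_of_neg (p := (· ≠ 0)) _ h, ← hF]
      refine ⟨by simp; omega, ?_⟩
      rw [Multiset.card_cons, Nat.succ_sub h1, Multiset.replicate_succ, Multiset.add_cons, ← h2,
        ha1]

theorem card_mem_and_parts_eq_of_move_eq {n : ℕ} {p q : n.Partition} (hn : n ≠ 0)
    (h : move p = q) :
    Multiset.card p.parts ∈ q.parts ∧ Multiset.card q.parts ≤ Multiset.card p.parts + 1 ∧
      p.parts = predParts q.parts (Multiset.card p.parts) := by
  have h0 : Multiset.card p.parts ≠ 0 := by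
    intro h0
    apply hn
    rw [← p.parts_sum, Multiset.card_eq_zero.1 h0, Multiset.sum_zero]
  have hq : q.parts = Multiset.card p.parts ::ₘ
      (p.parts.map (fun a => a - 1)).filter (· ≠ 0) := by
    rw [← h, parts_move, Multiset.filter_cons_of_pos (p := (· ≠ 0)) _ h0]
  obtain ⟨h1, h2⟩ := eq_map_succ_add_replicate p.parts fun a ha => p.parts_pos ha
  refine ⟨hq ▸ Multiset.mem_cons_self _ _, by rw [hq]; simpa using h1, ?_⟩
  rw [hq, predParts, Multiset.erase_cons_head, Multiset.card_cons, Nat.add_sub_add_right]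
  exact h2

/-- The partition before a move that yields `q` and whose new pile is `a`. -/
def pred {n : ℕ} (q : n.Partition) (a : ℕ) (ha : a ∈ q.parts)
    (hq : Multiset.card q.parts ≤ a + 1) : n.Partition where
  parts := predParts q.parts a
  parts_pos := by
    intro b hb
    rcases Multiset.mem_add.1 hb with hb | hb
    · obtain ⟨d, -, rfl⟩ := Multiset.mem_map.1 hb
      exact Nat.succ_pos d
    · simp [Multiset.eq_of_mem_replicate hb]
  parts_sum := by rw [sum_predParts ha hq, q.parts_sum]

/-! ### Counting iterated preimages by groups of equal piles -/

/-- The number of sequences of `j` choices from groups `0, 1, 2, …`, where the group `g` offers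
`n g` choices that are not distinguished, nothing is put back, and each choice is from a group at
most one further than the group before it; the first one is compared with the group `c`. -/
def groupCount : ℕ → (ℕ → ℕ) → ℕ → ℕ
  | 0, _, _ => 1
  | j + 1, n, c =>
    ∑ g ∈ Finset.range (c + 2) with 0 < n g, groupCount j (Function.update n g (n g - 1)) g

/-- The pile sizes `V 0 > V 1 > V 2 > ⋯` of groups of equal piles are spaced so that a pile of
size at least `V g - 2` belongs to one of the groups `0, …, g + 1`. -/
structure IsSpaced (V : ℕ → ℤ) : Prop where
  sub_two_le : ∀ g, V g - 2 ≤ V (g + 1)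
  lt : ∀ g, V (g + 1) < V g
  lt_sub_two : ∀ g, V (g + 2) < V g - 2

theorem IsSpaced.strictAnti {V : ℕ → ℤ} (hV : IsSpaced V) : StrictAnti V :=
  strictAnti_nat_of_succ_lt hV.lt

theorem IsSpaced.add_const {V : ℕ → ℤ} (hV : IsSpaced V) (z : ℤ) : IsSpaced fun g => V g + z where
  sub_two_le g := by have := hV.sub_two_le g; omega
  lt g := by have := hV.lt g; omega
  lt_sub_two g := by have := hV.lt_sub_two g; omega

theorem IsSpaced.comp_add {V : ℕ → ℤ} (hV : IsSpaced V) (c : ℕ) : IsSpaced fun g => V (g + c) where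
  sub_two_le g := by have := hV.sub_two_le (g + c); rwa [add_right_comm] at this
  lt g := by have := hV.lt (g + c); rwa [add_right_comm] at this
  lt_sub_two g := by have := hV.lt_sub_two (g + c); rwa [add_right_comm] at this

/-- The large piles of `s`, as far as they matter for `j` backward moves: they form groups of
equal piles, the group `g` consists of `n g` piles of size `V g`, and the next move would create
a pile that is one card smaller than those of the group `c`. -/
structure TopProfile (V : ℕ → ℤ) (s : Multiset ℕ) (n : ℕ → ℕ) (c j : ℕ) : Prop where
  card_eq : (Multiset.card s : ℤ) = V c - 1
  nonneg : 0 ≤ V (c + j + 1)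
  count_eq : ∀ g ≤ c + j, ∀ a : ℕ, (a : ℤ) = V g → s.count a = n g
  exists_eq : ∀ a ∈ s, V (c + j + 1) < a → ∃ g, (a : ℤ) = V g

/-- Going back one move by dealing out a pile of the group `g` makes `g` the current group and
takes one pile from it; all groups gain one card per pile. -/
theorem TopProfile.predParts {V : ℕ → ℤ} (hV : IsSpaced V) {s : Multiset ℕ} {n : ℕ → ℕ}
    {c j : ℕ} (h : TopProfile V s n c (j + 1)) {g a : ℕ} (hg : g ≤ c + 1) (ha : (a : ℤ) = V g)
    (has : a ∈ s) (hs : Multiset.card s ≤ a + 1) :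
    TopProfile (fun g => V g + 1) (predParts s a) (Function.update n g (n g - 1)) g j where
  card_eq := by rw [card_predParts has hs, ha]; omega
  nonneg := by
    have h1 := h.nonneg
    have h2 := hV.strictAnti.antitone (show g + j + 1 ≤ c + (j + 1) + 1 by omega)
    show 0 ≤ V (g + j + 1) + 1
    omega
  count_eq := by
    intro i hi b hb
    have h1 := h.nonneg
    have h2 := hV.strictAnti (show i < c + (j + 1) + 1 by omega)
    obtain ⟨d, rfl⟩ : ∃ d, b = d + 1 := ⟨b - 1, by omega⟩
    have hd : (d : ℤ) = V i := by push_cast at hb; omega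
    have h3 : (1 : ℕ) ≠ d + 1 := by omega
    rw [BulgarianSolitaire.predParts, Multiset.count_add, Multiset.count_replicate, if_neg h3,
      add_zero, Multiset.count_map_eq_count' _ _ (add_left_injective 1)]
    have h4 := h.count_eq i (by omega) d hd
    by_cases hig : i = g
    · subst hig
      have : d = a := by omega
      subst this
      rw [Multiset.count_erase_self, h4, Function.update_self]
    · have : d ≠ a := fun hda => hig (hV.strictAnti.injective (by omega))
      rw [Multiset.count_erase_of_ne this, h4, Function.update_of_ne hig]
  exists_eq := by
    intro b hb hlt
    have h1 := h.nonneg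
    have h2 := hV.strictAnti.antitone (show g + j + 1 ≤ c + (j + 1) + 1 by omega)
    rcases Multiset.mem_add.1 hb with hb | hb
    · obtain ⟨d, hd, rfl⟩ := Multiset.mem_map.1 hb
      push_cast at hlt
      obtain ⟨i, hi⟩ := h.exists_eq d (Multiset.mem_of_mem_erase hd) (by omega)
      exact ⟨i, by push_cast; omega⟩
    · rw [Multiset.eq_of_mem_replicate hb] at hlt
      push_cast at hlt
      omega

theorem TopProfile.card_iterate_preimage {m : ℕ} {V : ℕ → ℤ} (hV : IsSpaced V) {q : m.Partition}
    {n : ℕ → ℕ} {c j : ℕ} (h : TopProfile V q.parts n c j) :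
    (Finset.univ.filter fun p : m.Partition => move^[j] p = q).card = groupCount j n c := by
  induction j generalizing V q n c with
  | zero => exact Finset.card_eq_one.2 ⟨q, by ext; rw [Finset.mem_filter]; simp⟩
  | succ j ih =>
    have hcard := h.card_eq
    have hm : m ≠ 0 := by
      intro hm
      have h0 : q.parts = 0 := by
        rw [Multiset.eq_zero_iff_forall_notMem]
        intro a ha
        have h1 := q.parts_pos ha
        have h2 := Multiset.le_sum_of_mem ha
        rw [q.parts_sum] at h2
        omega
      have h1 := h.nonneg
      have h2 := hV.strictAnti (show c < c + 1 by omega)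
      have h3 := hV.strictAnti (show c + 1 < c + (j + 1) + 1 by omega)
      rw [h0] at hcard
      simp at hcard
      omega
    have hsum : (Finset.univ.filter fun p : m.Partition => move^[j + 1] p = q).card =
        ∑ p' : m.Partition with move p' = q,
          (Finset.univ.filter fun p : m.Partition => move^[j] p = p').card := by
      rw [Finset.card_eq_sum_card_fiberwise (f := fun p => move^[j] p)
        (t := Finset.univ.filter fun p' : m.Partition => move p' = q)]
      · refine Finset.sum_congr rfl fun p' hp' => ?_
        congr 1
        ext p
        have hp' := (Finset.mem_filter.1 hp').2
        simp only [Finset.mem_filter, Finset.mem_univ, true_and, Function.iterate_succ_apply']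
        exact ⟨fun h => h.2, fun h => ⟨by rw [h, hp'], h⟩⟩
      · intro p hp
        simpa [Function.iterate_succ_apply'] using hp
    rw [hsum, groupCount]
    -- the groups that may be chosen correspond to the piles of `q` that a move may have created
    have key : ∀ g ≤ c + 1, 0 < n g → ∃ a : ℕ, (a : ℤ) = V g ∧ a ∈ q.parts ∧
        Multiset.card q.parts ≤ a + 1 := by
      intro g hg hng
      have h1 := h.nonneg
      have h2 := hV.strictAnti.antitone (show g ≤ c + (j + 1) + 1 by omega)
      have h3 := hV.strictAnti.antitone hg
      have h4 := hV.sub_two_le c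
      refine ⟨(V g).toNat, by omega, ?_, by omega⟩
      rw [← Multiset.count_pos, h.count_eq g (by omega) _ (by omega)]
      exact hng
    choose! A hA using key
    have hmem : ∀ g ∈ (Finset.range (c + 2)).filter (fun g => 0 < n g), g ≤ c + 1 ∧ 0 < n g := by
      intro g hg
      rw [Finset.mem_filter, Finset.mem_range] at hg
      exact ⟨by omega, hg.2⟩
    symm
    refine Finset.sum_bij (fun g hg => pred q (A g)
      (hA g (hmem g hg).1 (hmem g hg).2).2.1 (hA g (hmem g hg).1 (hmem g hg).2).2.2)
      ?_ ?_ ?_ ?_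
    · intro g hg
      obtain ⟨-, h2, h3⟩ := hA g (hmem g hg).1 (hmem g hg).2
      simp only [Finset.mem_filter, Finset.mem_univ, true_and]
      exact move_eq_of_parts_eq_predParts h2 h3 rfl
    · intro g hg g' hg' heq
      obtain ⟨h1, h2, h3⟩ := hA g (hmem g hg).1 (hmem g hg).2
      obtain ⟨h1', h2', h3'⟩ := hA g' (hmem g' hg').1 (hmem g' hg').2
      have heq' := congrArg (fun p => Multiset.card p.parts) heq
      simp only [pred, card_predParts h2 h3, card_predParts h2' h3'] at heq'
      exact hV.strictAnti.injective (by rw [← h1, ← h1', heq'])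
    · intro p hp
      rw [Finset.mem_filter] at hp
      obtain ⟨h1, h2, h3⟩ := card_mem_and_parts_eq_of_move_eq hm hp.2
      have h4 := hV.lt_sub_two c
      have h5 := hV.strictAnti.antitone (show c + 2 ≤ c + (j + 1) + 1 by omega)
      obtain ⟨g, hg⟩ := h.exists_eq _ h1 (by omega)
      have h6 : g < c + 2 := hV.strictAnti.lt_iff_gt.1 (by omega)
      have h7 : 0 < n g := by
        rw [← h.count_eq g (by omega) _ hg, Multiset.count_pos]
        exact h1
      have h8 : A g = Multiset.card p.parts := by
        have := (hA g (by omega) h7).1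
        omega
      refine ⟨g, by simp [h6, h7], ?_⟩
      apply Nat.Partition.ext
      rw [h3, ← h8]
      rfl
    · intro g hg
      obtain ⟨h1, h2, h3⟩ := hA g (hmem g hg).1 (hmem g hg).2
      exact (ih (hV.add_const 1) (h.predParts hV (hmem g hg).1 h1 h2 h3)).symm

/-! ### Words and recurrent partitions -/

theorem wordParts_concat (w : List Bead) (b : Bead) :
    wordParts (w ++ [b]) = (wordParts w).map (· + 1) ++ [b.weight] := by
  induction w with
  | nil => simp [wordParts]
  | cons a w ih => simp [wordParts, ih]; omega

theorem length_wordParts (w : List Bead) : (wordParts w).length = w.length := by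
  induction w with
  | nil => rfl
  | cons a w ih => simp [wordParts, ih]

theorem wordParts_map_range (f : ℕ → Bead) (m : ℕ) :
    wordParts ((List.range m).map f) =
      (List.range m).map fun i => m - 1 - i + (f i).weight := by
  induction m generalizing f with
  | zero => rfl
  | succ m ih =>
    rw [List.range_succ_eq_map, List.map_cons, List.map_map, wordParts, ih, List.map_cons,
      List.map_map]
    simp only [List.length_map, List.length_range, Function.comp_def]
    congr 1
    refine List.map_congr_left fun i _ => ?_
    congr 1
    omega

theorem wordParts_injective_of_length {w w' : List Bead} (hl : w.length = w'.length)
    (h : wordParts w = wordParts w') : w = w' := by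
  induction w generalizing w' with
  | nil => exact (List.length_eq_zero_iff.1 hl.symm).symm
  | cons a w ih =>
    cases w' with
    | nil => simp at hl
    | cons a' w' =>
      simp only [List.length_cons, Nat.add_right_cancel_iff] at hl
      simp only [wordParts, List.cons.injEq, hl, Nat.add_left_cancel_iff] at h
      rw [ih hl h.2]
      congr 1
      have := h.1
      cases a <;> cases a' <;> simp_all [Bead.weight]

theorem le_length_of_mem_wordParts {w : List Bead} {a : ℕ} (ha : a ∈ wordParts w) :
    a ≤ w.length := by
  induction w with
  | nil => simp [wordParts] at ha
  | cons b w ih =>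
    rw [wordParts, List.mem_cons] at ha
    rcases ha with rfl | ha
    · cases b <;> simp [Bead.weight]
    · exact (ih ha).trans (by simp)

theorem pairwise_wordParts (w : List Bead) : (wordParts w).Pairwise (· ≥ ·) := by
  induction w with
  | nil => simp [wordParts]
  | cons b w ih =>
    rw [wordParts, List.pairwise_cons]
    exact ⟨fun a ha => (le_length_of_mem_wordParts ha).trans (by omega), ih⟩

/-- The piles of the partition of a word. -/
def wordPiles (w : List Bead) : Multiset ℕ :=
  ((wordParts w).filter (fun a => a ≠ 0) : List ℕ)

theorem wordPiles_eq_filter (w : List Bead) :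
    wordPiles w = (wordParts w : Multiset ℕ).filter (· ≠ 0) := rfl

/-- The partition of a word determines the word among those of the same length: the omitted part
`0` is restored by the length. -/
theorem wordPiles_injective_of_length {w w' : List Bead} (hl : w.length = w'.length)
    (h : wordPiles w = wordPiles w') : w = w' := by
  apply wordParts_injective_of_length hl
  refine List.Perm.eq_of_pairwise (le := (· ≥ ·)) (fun a b _ _ h1 h2 => le_antisymm h2 h1)
    (pairwise_wordParts w) (pairwise_wordParts w') ?_
  rw [← Multiset.coe_eq_coe]
  have key : ∀ v : List Bead, (wordParts v : Multiset ℕ) =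
      wordPiles v + Multiset.replicate (v.length - Multiset.card (wordPiles v)) 0 := by
    intro v
    have h1 := Multiset.filter_add_not (· ≠ 0) (wordParts v : Multiset ℕ)
    have h2 : (wordParts v : Multiset ℕ).filter (fun a => ¬ a ≠ 0) =
        Multiset.replicate (Multiset.card ((wordParts v : Multiset ℕ).filter fun a => ¬ a ≠ 0)) 0 :=
      Multiset.eq_replicate_card.2 fun a ha => not_not.1 (Multiset.mem_filter.1 ha).2
    have h3 := congrArg Multiset.card h1
    rw [Multiset.card_add, Multiset.coe_card, length_wordParts, ← wordPiles_eq_filter] at h3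
    rw [h2, ← wordPiles_eq_filter] at h1
    rw [← h1, ← h3, Nat.add_sub_cancel_left]
  rw [key w, key w', h, hl]

theorem wordPiles_concat (w : List Bead) (b : Bead) :
    wordPiles (w ++ [b]) =
      (((wordParts w).map (· + 1) : List ℕ) : Multiset ℕ) + Multiset.replicate b.weight 1 := by
  rw [wordPiles_eq_filter, wordParts_concat, ← Multiset.coe_add, Multiset.filter_add]
  congr 1
  · refine Multiset.filter_eq_self.2 fun a ha => ?_
    obtain ⟨d, -, rfl⟩ := List.mem_map.1 (Multiset.mem_coe.1 ha)
    exact Nat.succ_ne_zero d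
  · cases b <;> rfl

theorem card_wordPiles_concat (w : List Bead) (b : Bead) :
    Multiset.card (wordPiles (w ++ [b])) = w.length + b.weight := by
  rw [wordPiles_concat, Multiset.card_add, Multiset.coe_card, List.length_map, length_wordParts,
    Multiset.card_replicate]

/-- A move rotates the word of a recurrent partition. -/
theorem parts_move_of_parts_eq {n : ℕ} {p : n.Partition} {w : List Bead} {b : Bead}
    (hp : p.parts = wordPiles (w ++ [b])) : (move p).parts = wordPiles (b :: w) := by
  rw [parts_move, hp, card_wordPiles_concat, wordPiles_concat, wordPiles_eq_filter, wordParts,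
    ← Multiset.cons_coe, Multiset.map_add,
    Multiset.filter_cons, Multiset.filter_cons, Multiset.filter_add, Multiset.map_coe,
    List.map_map]
  have h : (Multiset.map (fun a => a - 1) (Multiset.replicate b.weight 1)).filter (· ≠ 0) = 0 := by
    cases b <;> rfl
  rw [h, add_zero]
  simp [Function.comp_def]

theorem move_mem_recurrentSet {N : Necklace} {p : (cards N).Partition} (hp : p ∈ recurrentSet N) :
    move p ∈ recurrentSet N := by
  obtain ⟨w, hw, hp⟩ := hp
  rcases List.eq_nil_or_concat w with rfl | ⟨w, b, rfl⟩
  · refine ⟨[], hw, ?_⟩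
    rw [parts_move, hp]
    rfl
  · rw [List.concat_eq_append] at hw hp
    refine ⟨b :: w, ?_, parts_move_of_parts_eq hp⟩
    rw [← hw, Cycle.coe_eq_coe]
    exact List.IsRotated.symm ⟨w.length, by simp⟩

theorem iterate_move_mem_recurrentSet {N : Necklace} {p : (cards N).Partition} {i j : ℕ}
    (hij : i ≤ j) (hp : move^[i] p ∈ recurrentSet N) : move^[j] p ∈ recurrentSet N := by
  induction j, hij using Nat.le_induction with
  | base => exact hp
  | succ j _ ih =>
    rw [Function.iterate_succ_apply']
    exact move_mem_recurrentSet ih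

/-! ### Level sizes -/

open Classical in
/-- The number of partitions that reach the recurrent cycle of `N` within `j` moves. -/
noncomputable def reachCount (N : Necklace) (j : ℕ) : ℕ :=
  (Finset.univ.filter fun p : (cards N).Partition => move^[j] p ∈ recurrentSet N).card

theorem move_iterate_mem_iff {N : Necklace} {p : (cards N).Partition} {j : ℕ} :
    move^[j] p ∈ recurrentSet N ↔ p ∈ orbit N ∧ level N p ≤ j := by
  constructor
  · intro h
    exact ⟨⟨j + 1, j.succ_pos, iterate_move_mem_recurrentSet j.le_succ h⟩, Nat.sInf_le h⟩
  · rintro ⟨⟨k, -, hk⟩, hle⟩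
    have h : level N p ∈ {k : ℕ | move^[k] p ∈ recurrentSet N} := Nat.sInf_mem ⟨k, hk⟩
    exact iterate_move_mem_recurrentSet hle h

open Classical in
theorem coeff_levelGF (N : Necklace) (j : ℕ) :
    PowerSeries.coeff j (levelGF N) = ((Finset.univ.filter fun p : (cards N).Partition =>
      p ∈ orbit N ∧ level N p = j).card : ℤ) := by
  rw [levelGF, map_sum]
  simp only [PowerSeries.coeff_X_pow, Finset.sum_boole, Finset.filter_filter, eq_comm]

theorem coeff_levelGF_zero (N : Necklace) :
    PowerSeries.coeff 0 (levelGF N) = (reachCount N 0 : ℤ) := by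
  classical
  rw [coeff_levelGF, reachCount]
  congr 2
  ext p
  rw [Finset.mem_filter, Finset.mem_filter, move_iterate_mem_iff, Nat.le_zero]

theorem coeff_levelGF_succ (N : Necklace) (j : ℕ) :
    PowerSeries.coeff (j + 1) (levelGF N) = (reachCount N (j + 1) : ℤ) - reachCount N j := by
  classical
  rw [coeff_levelGF, reachCount, reachCount, eq_sub_iff_add_eq, ← Nat.cast_add,
    ← Finset.card_union_of_disjoint]
  · congr 2
    ext p
    simp only [Finset.mem_union, Finset.mem_filter, Finset.mem_univ, true_and,
      move_iterate_mem_iff, Nat.le_succ_iff, Nat.succ_eq_add_one]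
    tauto
  · rw [Finset.disjoint_filter]
    intro p _ h1 h2
    have := (move_iterate_mem_iff.1 h2).2
    omega

/-- If the numbers `reachCount` stabilize, the level size generating functions converge. -/
theorem isLimitGF_of_eventually_reachCount_eq {P : List Bead} {h : ℕ → ℕ}
    (hP : ∀ j, ∀ᶠ l in atTop, reachCount (wordPow P l : Cycle Bead) j = h j) :
    IsLimitGF P (PowerSeries.mk fun j => (h j : ℤ) - if j = 0 then 0 else (h (j - 1) : ℤ)) := by
  rw [IsLimitGF, PowerSeries.WithPiTopology.tendsto_iff_coeff_tendsto]
  intro j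
  apply tendsto_const_nhds.congr'
  cases j with
  | zero =>
    filter_upwards [hP 0] with l hl
    simp [coeff_levelGF_zero, hl]
  | succ j =>
    filter_upwards [hP j, hP (j + 1)] with l hl hl'
    simp [coeff_levelGF_succ, hl, hl']

theorem wordPow_map_range {f : ℕ → Bead} {n : ℕ} (hf : Function.Periodic f n) (l : ℕ) :
    wordPow ((List.range n).map f) l = (List.range (l * n)).map f := by
  induction l with
  | zero => simp [wordPow]
  | succ l ih =>
    rw [wordPow, List.replicate_succ', List.flatten_concat, ← wordPow, ih, Nat.succ_mul,
      List.range_add, List.map_append, List.map_map]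
    congr 1
    refine List.map_congr_left fun i _ => ?_
    rw [Function.comp_apply, add_comm]
    exact (hf.nat_mul l i).symm

/-- The number of partitions that reach the recurrent cycle of `N` within `j` moves is counted
along the distinct words `w i` that represent `N`. -/
theorem reachCount_eq_sum {N : Necklace} {j : ℕ} {s : Finset ℕ} {w : ℕ → List Bead} {c : ℕ → ℕ}
    (hw : ∀ v : List Bead, (v : Cycle Bead) = N ↔ ∃ i ∈ s, v = w i) (hinj : Set.InjOn w s)
    (hc : ∀ i ∈ s, ∀ q : (cards N).Partition, q.parts = wordPiles (w i) →
      (Finset.univ.filter fun p : (cards N).Partition => move^[j] p = q).card = c i) :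
    reachCount N j = ∑ i ∈ s, c i := by
  classical
  have hwN : ∀ i ∈ s, (w i : Cycle Bead) = N := fun i hi => (hw _).2 ⟨i, hi, rfl⟩
  have hq : ∀ i ∈ s, ∃ q : (cards N).Partition, q.parts = wordPiles (w i) := by
    intro i hi
    refine ⟨Nat.Partition.ofSums _ (wordParts (w i) : Multiset ℕ) ?_, rfl⟩
    rw [Multiset.sum_coe, wordParts_sum, hwN i hi]
  have : Nonempty (cards N).Partition := ⟨Nat.Partition.indiscrete _⟩
  choose! q hq using hq
  have hU : (Finset.univ.filter fun p : (cards N).Partition => move^[j] p ∈ recurrentSet N) =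
      s.biUnion fun i => Finset.univ.filter fun p => move^[j] p = q i := by
    ext p
    simp only [Finset.mem_filter, Finset.mem_univ, true_and, Finset.mem_biUnion]
    constructor
    · rintro ⟨v, hv, hp⟩
      obtain ⟨i, hi, rfl⟩ := (hw v).1 hv
      exact ⟨i, hi, Nat.Partition.ext (hp.trans (hq i hi).symm)⟩
    · rintro ⟨i, hi, hp⟩
      exact ⟨w i, hwN i hi, by rw [hp, hq i hi]; rfl⟩
  rw [reachCount, hU, Finset.card_biUnion]
  · exact Finset.sum_congr rfl fun i hi => hc i hi _ (hq i hi)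
  · intro i hi i' hi' hne
    rw [Function.onFun, Finset.disjoint_filter]
    intro p _ h h'
    refine hne (hinj hi hi' (wordPiles_injective_of_length ?_ ?_))
    · rw [← Cycle.length_coe, hwN i hi, ← hwN i' hi', Cycle.length_coe]
    · rw [← hq i hi, ← hq i' hi', ← h, ← h']

/-! ### The periodic words `X(WB)^k X(WB)^k ⋯` -/

/-- The bead at position `i` of the periodic sequence `X(WB)^k X(WB)^k ⋯`. -/
def bead (X : Bead) (k i : ℕ) : Bead :=
  if i % (2 * k + 1) = 0 then X else if i % (2 * k + 1) % 2 = 1 then Bead.W else Bead.B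

/-- The index of the group that contains the position `i` of `X(WB)^k X(WB)^k ⋯`, where each `X`
and each pair `WB` is a group. -/
def groupIdx (k i : ℕ) : ℕ :=
  i / (2 * k + 1) * (k + 1) + (i % (2 * k + 1) + 1) / 2

/-- The common value of `s_i - i` for the positions `i` in the group `g` of `X(WB)^k X(WB)^k ⋯`,
where `s_i` is the weight of the bead at `i`. -/
def groupHeight (X : Bead) (k g : ℕ) : ℤ :=
  (if g % (k + 1) = 0 then (X.weight : ℤ) else 1 - 2 * (g % (k + 1) : ℕ)) -
    (g / (k + 1) : ℕ) * (2 * k + 1)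

/-- The number of positions after `i₀` in the `g`-th group after the one of `i₀`. -/
def groupSize (k i₀ g : ℕ) : ℕ :=
  ((Finset.range (2 * (g + groupIdx k i₀) + 1)).filter fun i =>
    groupIdx k (i₀ + 1 + i) = g + groupIdx k i₀).card

/-- The word of the `m` letters of `X(WB)^k X(WB)^k ⋯` after position `i₀`. -/
def shiftedWord (X : Bead) (k m i₀ : ℕ) : List Bead :=
  (List.range m).map fun i => bead X k (i₀ + 1 + i)

/-! ### Groups of equal piles in the recurrent partitions -/

theorem bead_periodic (X : Bead) (k : ℕ) : Function.Periodic (bead X k) (2 * k + 1) := by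
  intro i
  simp [bead]

theorem bead_eq_of_modEq {X : Bead} {k i i' : ℕ} (h : i ≡ i' [MOD 2 * k + 1]) :
    bead X k i = bead X k i' := by
  rw [bead, bead, h]

theorem groupHeight_groupIdx (X : Bead) (k i : ℕ) :
    groupHeight X k (groupIdx k i) = (bead X k i).weight - i := by
  have hr : i % (2 * k + 1) < 2 * k + 1 := Nat.mod_lt _ (by omega)
  have hi : (i : ℤ) = (i / (2 * k + 1) : ℕ) * (2 * k + 1) + (i % (2 * k + 1) : ℕ) := by
    have := Nat.div_add_mod' i (2 * k + 1)
    exact_mod_cast this.symm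
  have ht : (i % (2 * k + 1) + 1) / 2 < k + 1 := by omega
  have h1 : groupIdx k i % (k + 1) = (i % (2 * k + 1) + 1) / 2 := by
    rw [groupIdx, mul_comm, Nat.mul_add_mod, Nat.mod_eq_of_lt ht]
  have h2 : groupIdx k i / (k + 1) = i / (2 * k + 1) := by
    rw [groupIdx, mul_comm, Nat.mul_add_div (by omega), Nat.div_eq_of_lt ht, add_zero]
  rw [groupHeight, h1, h2, bead]
  set q := i / (2 * k + 1)
  set r := i % (2 * k + 1)
  rw [hi]
  split_ifs with h3 h4 h5 h6 h7
  · simp [h4]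
  all_goals first | omega | (simp only [Bead.weight]; push_cast; omega)

theorem succ_div_mod (k g : ℕ) :
    (g + 1) / (k + 1) = (if g % (k + 1) = k then g / (k + 1) + 1 else g / (k + 1)) ∧
      (g + 1) % (k + 1) = if g % (k + 1) = k then 0 else g % (k + 1) + 1 := by
  have h := Nat.mod_add_div g (k + 1)
  have hlt := Nat.mod_lt g (show k + 1 > 0 by omega)
  rw [Nat.div_mod_unique (by omega)]
  split_ifs with h1
  · rw [mul_add]
    omega
  · omega

/-- From `X` to the first pair the pile size drops by `1 + s`, from the last pair to the next `X`
by `2 - s`, where `s` is the weight of `X`; from pair to pair it drops by `2`. -/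
theorem groupHeight_succ (X : Bead) {k : ℕ} (hk : 1 ≤ k) (g : ℕ) :
    groupHeight X k (g + 1) = groupHeight X k g -
      if g % (k + 1) = k then 2 - (X.weight : ℤ)
      else if g % (k + 1) = 0 then 1 + (X.weight : ℤ) else 2 := by
  obtain ⟨h1, h2⟩ := succ_div_mod k g
  rw [groupHeight, groupHeight, h1, h2]
  split_ifs <;> first | contradiction | omega | (push_cast; linarith)

theorem isSpaced_groupHeight (X : Bead) {k : ℕ} (hk : 1 ≤ k) : IsSpaced (groupHeight X k) := by
  have hX : X.weight ≤ 1 := by cases X <;> simp [Bead.weight]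
  refine ⟨fun g => ?_, fun g => ?_, fun g => ?_⟩
  · rw [groupHeight_succ X hk]
    split_ifs <;> omega
  · rw [groupHeight_succ X hk]
    split_ifs <;> omega
  · rw [groupHeight_succ X hk (g + 1), groupHeight_succ X hk g, (succ_div_mod k g).2]
    by_cases h : g % (k + 1) = k
    · rw [if_pos h, if_pos h, if_neg (by omega), if_pos rfl]
      omega
    · rw [if_neg h, if_neg h, if_neg (Nat.succ_ne_zero _)]
      split_ifs <;> omega

theorem le_two_mul_groupIdx (k i : ℕ) : i ≤ 2 * groupIdx k i := by
  have hi := Nat.div_add_mod' i (2 * k + 1)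
  rw [groupIdx]
  have h : i / (2 * k + 1) * (2 * k + 1) ≤ 2 * (i / (2 * k + 1) * (k + 1)) := by
    rw [mul_left_comm]
    exact Nat.mul_le_mul_left _ (by omega)
  omega

theorem groupIdx_le_self (k i : ℕ) : groupIdx k i ≤ i := by
  have hi := Nat.div_add_mod' i (2 * k + 1)
  rw [groupIdx]
  have h : i / (2 * k + 1) * (k + 1) ≤ i / (2 * k + 1) * (2 * k + 1) :=
    Nat.mul_le_mul_left _ (by omega)
  omega

theorem neg_two_mul_le_groupHeight (X : Bead) (k g : ℕ) :
    -(2 * (g : ℤ)) ≤ groupHeight X k g := by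
  have h1 : (g : ℤ) = (g / (k + 1) : ℕ) * (k + 1) + (g % (k + 1) : ℕ) := by
    have := Nat.div_add_mod' g (k + 1)
    exact_mod_cast this.symm
  rw [groupHeight]
  have h2 : (0 : ℤ) ≤ (g / (k + 1) : ℕ) := by positivity
  split_ifs with h
  · nlinarith
  · nlinarith

/-- For a word `X(WB)^k ⋯ X(WB)^k`, up to rotation, the sizes of the groups of equal piles do not
depend on `X`. -/
theorem topProfile_shiftedWord (X : Bead) {k : ℕ} (hk : 1 ≤ k) {l i₀ j : ℕ}
    (hi : i₀ < 2 * k + 1) (hl : 2 * (j + 1 + 2 * k) + 1 ≤ l * (2 * k + 1)) :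
    TopProfile (fun g => groupHeight X k (g + groupIdx k i₀) + ((l * (2 * k + 1) : ℕ) + i₀))
      (wordPiles (shiftedWord X k (l * (2 * k + 1)) i₀)) (groupSize k i₀) 0 j where
  card_eq := by
    obtain ⟨m, hm⟩ : ∃ m, l * (2 * k + 1) = m + 1 := ⟨l * (2 * k + 1) - 1, by omega⟩
    have h : bead X k (i₀ + 1 + m) = bead X k i₀ := by
      rw [show i₀ + 1 + m = i₀ + l * (2 * k + 1) by omega]
      exact (bead_periodic X k).nat_mul l i₀
    rw [shiftedWord, hm, List.range_succ, List.map_append, List.map_singleton,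
      card_wordPiles_concat, h]
    simp only [zero_add, groupHeight_groupIdx, List.length_map, List.length_range]
    push_cast
    ring
  nonneg := by
    -- a group takes up at most two positions, so the first groups end well before the word does
    have h1 := neg_two_mul_le_groupHeight X k (0 + j + 1 + groupIdx k i₀)
    have h2 := groupIdx_le_self k i₀
    show 0 ≤ groupHeight X k (0 + j + 1 + groupIdx k i₀) + (((l * (2 * k + 1) : ℕ) : ℤ) + i₀)
    generalize l * (2 * k + 1) = m at hl ⊢
    omega
  count_eq := by
    intro g hg a ha
    have h1 := neg_two_mul_le_groupHeight X k (g + groupIdx k i₀)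
    have h2 := groupIdx_le_self k i₀
    generalize l * (2 * k + 1) = m at hl ha
    have ha0 : a ≠ 0 := by omega
    rw [wordPiles_eq_filter, Multiset.count_filter_of_pos (p := (· ≠ 0)) ha0, shiftedWord,
      wordParts_map_range, ← Multiset.map_coe, Multiset.count_map, groupSize,
      Multiset.coe_range, ← Finset.range_val, ← Finset.filter_val, Finset.card_val]
    congr 1
    ext i
    simp only [Finset.mem_filter, Finset.mem_range]
    -- the pile at position `i₀ + 1 + i` has the size that belongs to its group
    have h3 := groupHeight_groupIdx X k (i₀ + 1 + i)
    have h4 := le_two_mul_groupIdx k (i₀ + 1 + i)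
    constructor
    · rintro ⟨hi1, hi2⟩
      have h5 : groupIdx k (i₀ + 1 + i) = g + groupIdx k i₀ :=
        (isSpaced_groupHeight X hk).strictAnti.injective (by omega)
      exact ⟨by omega, h5⟩
    · rintro ⟨hi1, hi2⟩
      rw [hi2] at h3
      exact ⟨by omega, by omega⟩
  exists_eq := by
    intro a ha _
    generalize l * (2 * k + 1) = m at hl ha ⊢
    rw [wordPiles_eq_filter, shiftedWord, wordParts_map_range, Multiset.mem_filter,
      Multiset.mem_coe, List.mem_map] at ha
    obtain ⟨⟨i, hi1, rfl⟩, -⟩ := ha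
    rw [List.mem_range] at hi1
    have h3 := groupHeight_groupIdx X k (i₀ + 1 + i)
    have h4 : groupIdx k i₀ ≤ groupIdx k (i₀ + 1 + i) := by
      by_contra! h
      have h5 := (isSpaced_groupHeight X hk).strictAnti h
      have h6 := groupHeight_groupIdx X k i₀
      have h7 : (bead X k (i₀ + 1 + i)).weight ≤ 1 := by
        cases bead X k (i₀ + 1 + i) <;> simp [Bead.weight]
      omega
    refine ⟨groupIdx k (i₀ + 1 + i) - groupIdx k i₀, ?_⟩
    rw [Nat.sub_add_cancel h4, h3]
    omega

/-! ### Rotations of the periodic words -/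

theorem shiftedWord_congr {X : Bead} {k m i i' : ℕ} (h : i ≡ i' [MOD 2 * k + 1]) :
    shiftedWord X k m i = shiftedWord X k m i' :=
  List.map_congr_left fun x _ => bead_eq_of_modEq ((h.add_right 1).add_right x)

theorem rotate_shiftedWord (X : Bead) (k l i n : ℕ) :
    (shiftedWord X k (l * (2 * k + 1)) i).rotate n = shiftedWord X k (l * (2 * k + 1)) (i + n) := by
  refine List.ext_getElem (by simp [shiftedWord]) fun x h1 h2 => ?_
  rw [List.getElem_rotate]
  simp only [shiftedWord, List.getElem_map, List.getElem_range, List.length_map, List.length_range]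
  apply bead_eq_of_modEq
  rw [show i + n + 1 + x = i + 1 + (x + n) by omega]
  exact ((Nat.mod_modEq _ _).of_dvd (Dvd.intro_left l rfl)).add_left _

theorem coe_eq_shiftedWord_iff (X : Bead) (k l i₀ : ℕ) (v : List Bead) :
    (v : Cycle Bead) = (shiftedWord X k (l * (2 * k + 1)) i₀ : Cycle Bead) ↔
      ∃ i ∈ Finset.range (2 * k + 1), v = shiftedWord X k (l * (2 * k + 1)) i := by
  rw [eq_comm, Cycle.coe_eq_coe]
  constructor
  · rintro ⟨n, rfl⟩
    refine ⟨(i₀ + n) % (2 * k + 1), Finset.mem_range.2 (Nat.mod_lt _ (by omega)), ?_⟩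
    rw [rotate_shiftedWord]
    exact shiftedWord_congr (Nat.mod_modEq _ _).symm
  · rintro ⟨i, -, rfl⟩
    refine ⟨i + i₀ * (2 * k), ?_⟩
    rw [rotate_shiftedWord]
    apply shiftedWord_congr
    rw [show i₀ + (i + i₀ * (2 * k)) = i + i₀ * (2 * k + 1) by ring]
    simp [Nat.ModEq]

/-- The word `X(WB)^k` is primitive. -/
theorem not_periodic_bead (X : Bead) {k d : ℕ} (hk : 1 ≤ k) (hd : d ≠ 0) (hd' : d < 2 * k + 1) :
    ¬ Function.Periodic (bead X k) d := by
  intro h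
  have h0 := h 0
  simp only [bead, zero_add, Nat.zero_mod, if_true, Nat.mod_eq_of_lt hd', hd, if_false] at h0
  cases X with
  -- the position `2 k + 1 - d` holds `W`, since `d` is even, but `2 k + 1` holds `X = B`
  | B =>
    have hodd : d % 2 ≠ 1 := by
      intro hodd
      simp [hodd] at h0
    have h1 := h (2 * k + 1 - d)
    have h2 : (2 * k + 1 - d) % 2 = 1 := by omega
    have h3 : 2 * k + 1 - d ≠ 0 := by omega
    rw [Nat.sub_add_cancel hd'.le, bead, bead, Nat.mod_self,
      Nat.mod_eq_of_lt (show 2 * k + 1 - d < 2 * k + 1 by omega)] at h1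
    simp [h2, h3] at h1
  -- the position `1` holds `W`, but `1 + d` holds `B`, since `d` is odd
  | W =>
    have hodd : d % 2 = 1 := by
      by_contra hodd
      simp [hodd] at h0
    have h1 := h 1
    have h2 : (1 + d) % 2 = 0 := by omega
    rw [bead, bead, Nat.mod_eq_of_lt (show 1 < 2 * k + 1 by omega),
      Nat.mod_eq_of_lt (show 1 + d < 2 * k + 1 by omega)] at h1
    simp [h2] at h1

theorem injOn_shiftedWord (X : Bead) {k l : ℕ} (hk : 1 ≤ k) (hl : 1 ≤ l) :
    Set.InjOn (shiftedWord X k (l * (2 * k + 1))) (Finset.range (2 * k + 1) : Set ℕ) := by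
  have key : ∀ i i' : ℕ, i < i' → i' < 2 * k + 1 →
      shiftedWord X k (l * (2 * k + 1)) i ≠ shiftedWord X k (l * (2 * k + 1)) i' := by
    intro i i' hlt hi' h
    refine not_periodic_bead X hk (show i' - i ≠ 0 by omega) (by omega) fun x => ?_
    have h1 : (x + 2 * k - i) % (2 * k + 1) < l * (2 * k + 1) :=
      (Nat.mod_lt _ (by omega)).trans_le (Nat.le_mul_of_pos_left _ hl)
    have h2 := List.map_inj_left.1 h _ (List.mem_range.2 h1)
    have h3 : ∀ y, y + 1 + (x + 2 * k - i) % (2 * k + 1) ≡ y + 1 + (x + 2 * k - i)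
        [MOD 2 * k + 1] := fun y => (Nat.mod_modEq _ _).add_left _
    rw [bead_eq_of_modEq (h3 i), bead_eq_of_modEq (h3 i'),
      show i + 1 + (x + 2 * k - i) = x + (2 * k + 1) by omega,
      show i' + 1 + (x + 2 * k - i) = x + (i' - i) + (2 * k + 1) by omega,
      bead_periodic, bead_periodic] at h2
    exact h2.symm
  intro i hi i' hi' h
  rw [Finset.mem_coe, Finset.mem_range] at hi hi'
  rcases lt_trichotomy i i' with hlt | heq | hlt
  · exact absurd h (key i i' hlt hi')
  · exact heq
  · exact absurd h.symm (key i' i hlt hi)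

/-! ### The limits -/

/-- The right-hand side depends neither on `l` nor on `X`. -/
theorem reachCount_shiftedWord (X : Bead) {k : ℕ} (hk : 1 ≤ k) (i₀ : ℕ) {l j : ℕ}
    (hl : 2 * (j + 1 + 2 * k) + 1 ≤ l) :
    reachCount (shiftedWord X k (l * (2 * k + 1)) i₀ : Cycle Bead) j =
      ∑ i ∈ Finset.range (2 * k + 1), groupCount j (groupSize k i) 0 := by
  refine reachCount_eq_sum (coe_eq_shiftedWord_iff X k l i₀)
    (injOn_shiftedWord X hk (by omega)) fun i hi q hq => ?_
  have hl' : l ≤ l * (2 * k + 1) := Nat.le_mul_of_pos_right l (by omega)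
  have h := topProfile_shiftedWord X hk (Finset.mem_range.1 hi) (hl.trans hl')
  rw [← hq] at h
  exact h.card_iterate_preimage (((isSpaced_groupHeight X hk).comp_add _).add_const _)

theorem wordPow_two_letters (a b : Bead) (k : ℕ) :
    wordPow [a, b] k = (List.range (k * 2)).map fun i => if i % 2 = 0 then a else b := by
  have h : Function.Periodic (fun i => if i % 2 = 0 then a else b) 2 := fun i => by simp
  exact wordPow_map_range h k

/-- `B(WB)^k` is the period `X(WB)^k` itself for `X = B`. -/
theorem wordPow_wordBWB (k l : ℕ) :
    ∃ i₀, wordPow (wordBWB k) l = shiftedWord Bead.B k (l * (2 * k + 1)) i₀ := by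
  refine ⟨2 * k, ?_⟩
  have h : Function.Periodic (fun i => bead Bead.B k (2 * k + 1 + i)) (2 * k + 1) :=
    (bead_periodic Bead.B k).const_add _
  rw [shiftedWord, ← wordPow_map_range h, wordBWB, wordPow_two_letters, List.range_succ_eq_map,
    List.map_cons, List.map_map, mul_comm k 2]
  congr 2
  · simp [bead]
  · refine List.map_congr_left fun i hi => ?_
    rw [List.mem_range] at hi
    have h1 : (2 * k + 1 + (i + 1)) % (2 * k + 1) = i + 1 := by
      rw [Nat.add_mod_left, Nat.mod_eq_of_lt (by omega)]
    simp only [Function.comp_apply, Nat.succ_eq_add_one, bead, h1]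
    split_ifs <;> first | rfl | omega

/-- `W(BW)^k` is the period `X(WB)^k` for `X = W`, read from its second letter on. -/
theorem wordPow_wordWBW {k : ℕ} (hk : 1 ≤ k) (l : ℕ) :
    ∃ i₀, wordPow (wordWBW k) l = shiftedWord Bead.W k (l * (2 * k + 1)) i₀ := by
  refine ⟨0, ?_⟩
  have h : Function.Periodic (fun i => bead Bead.W k (0 + 1 + i)) (2 * k + 1) :=
    (bead_periodic Bead.W k).const_add _
  rw [shiftedWord, ← wordPow_map_range h, wordWBW, wordPow_two_letters, List.range_succ_eq_map,
    List.map_cons, List.map_map, mul_comm k 2]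
  congr 2
  · have h1 : (0 + 1 + 0) % (2 * k + 1) = 1 := Nat.mod_eq_of_lt (by omega)
    simp only [bead, h1]
    split_ifs <;> rfl
  · refine List.map_congr_left fun i hi => ?_
    rw [List.mem_range] at hi
    simp only [Function.comp_apply, Nat.succ_eq_add_one, bead]
    rcases Nat.lt_or_ge (i + 1) (2 * k) with hik | hik
    · have h1 : (0 + 1 + (i + 1)) % (2 * k + 1) = i + 2 := by
        rw [Nat.mod_eq_of_lt (by omega)]
        omega
      rw [h1]
      split_ifs <;> first | rfl | omega
    · have h1 : 0 + 1 + (i + 1) = 2 * k + 1 := by omega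
      rw [h1, Nat.mod_self]
      split_ifs <;> first | rfl | omega

end BulgarianSolitaire

theorem theorem1p2 (k : ℕ) (hk : 1 ≤ k) :
    ∃ H : PowerSeries ℤ,
      BulgarianSolitaire.IsLimitGF (BulgarianSolitaire.wordBWB k) H ∧
      BulgarianSolitaire.IsLimitGF (BulgarianSolitaire.wordWBW k) H := by
  open BulgarianSolitaire in
  set h : ℕ → ℕ := fun j => ∑ i ∈ Finset.range (2 * k + 1), groupCount j (groupSize k i) 0
  refine ⟨_, isLimitGF_of_eventually_reachCount_eq (h := h) fun j => ?_,
    isLimitGF_of_eventually_reachCount_eq (h := h) fun j => ?_⟩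
  · filter_upwards [eventually_ge_atTop (2 * (j + 1 + 2 * k) + 1)] with l hl
    obtain ⟨i₀, hi₀⟩ := wordPow_wordBWB k l
    rw [hi₀, reachCount_shiftedWord Bead.B hk i₀ hl]
  · filter_upwards [eventually_ge_atTop (2 * (j + 1 + 2 * k) + 1)] with l hl
    obtain ⟨i₀, hi₀⟩ := wordPow_wordWBW hk l
    rw [hi₀, reachCount_shiftedWord Bead.W hk i₀ hl]
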